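/- Let $k$ be a field. Regard a representation of a group over $k$ as a two-sorted algebra $A=(A^{(1)},A^{(2)})$: sort $1$ is a group (operations: multiplication, inverse, unit), sort $2$ is a vector space over $k$ (operations: addition, negation, zero, and one unary operation for each scalar $\lambda\in k$), and there is one further operation $\circ$ of type $(1,2;2)$, which is an action of the group on the vector space by linear maps. A variety of representations of groups over $k$ is a class $\Theta$ of such two-sorted algebras which is the class of all algebras of this signature satisfying some set of identities. A variety $\Theta$ is $i$-nondegenerate if the identity $x_1^{(i)}=x_2^{(i)}$ between two different variables of sort $i$ does not hold in all algebras of $\Theta$, and nondegenerate if it is $i$-nondegenerate for every sort $i$. It is an $i$-IBN-variety if, whenever free algebras $F_\Theta(Y)$ and $F_\Theta(Z)$ of $\Theta$ with sets of free generators $Y=Y^{(1)}\uplus Y^{(2)}$ and $Z=Z^{(1)}\uplus Z^{(2)}$ are isomorphic, then $|Y^{(i)}|=|Z^{(i)}|$; and it is an IBN-variety if it is an $i$-IBN-variety for every sort $i$. (The same notions are used for one-sorted algebras.) Let $\Theta$ be a nondegenerate variety of representations of groups over $k$. Let $\Theta^{(1)}$ be the variety of one-sorted algebras in the signature of groups defined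 by all identities of $\Theta$ between terms of sort $1$. Let $\Delta\subseteq\Theta$ be the subvariety defined by the identity $x^{(1)}\circ x^{(2)}=x^{(2)}$, and let $\Delta^{(2)}$ be the variety of one-sorted algebras in the signature of vector spaces over $k$ defined by all identities of $\Delta$ between terms built only from variables of sort $2$ and the vector space operations. Then: 1. $\Theta$ is an IBN-variety; 2. $\Theta^{(1)}$ is a nondegenerate variety of groups, and it is an IBN-variety; 3. $\Delta^{(2)}$ is the variety of all vector spaces over $k$, and $\Delta$ is a $2$-nondegenerate $2$-IBN-variety. -/

import Mathlib

universe u v w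

namespace ManySorted

/-! ### Many-sorted algebras, terms, identities, varieties -/

/-- A many-sorted signature with set of names of sorts `Γ`: the operation `ω` has the type
`(dom ω 0, …, dom ω (arity ω - 1); cod ω)`. -/
structure Signature (Γ : Type v) where
  Op : Type w
  arity : Op → ℕ
  dom : (ω : Op) → Fin (arity ω) → Γ
  cod : Op → Γ

/-- A many-sorted algebra; `carrier i` is the (possibly empty) set of elements of sort `i`. -/
structure Alg {Γ : Type v} (S : Signature.{v, w} Γ) where
  carrier : Γ → Type u
  op : (ω : S.Op) → ((j : Fin (S.arity ω)) → carrier (S.dom ω j)) → carrier (S.cod ω)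

/-- Homomorphisms of many-sorted algebras: sort-preserving maps that respect all operations. -/
structure Hom {Γ : Type v} {S : Signature.{v, w} Γ} (A B : Alg.{u} S) where
  toFun : (i : Γ) → A.carrier i → B.carrier i
  map_op : ∀ (ω : S.Op) (a : (j : Fin (S.arity ω)) → A.carrier (S.dom ω j)),
    toFun (S.cod ω) (A.op ω a) = B.op ω (fun j => toFun (S.dom ω j) (a j))

/-- Two algebras are isomorphic if there is a homomorphism that is bijective on every sort. -/
def Isomorphic {Γ : Type v} {S : Signature.{v, w} Γ} (A B : Alg.{u} S) : Prop :=
  ∃ f : Hom A B, ∀ i, Function.Bijective (f.toFun i)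

/-- For a set `X` of variables, `Letters X i` is the set of those variables from `X` that have
sort `i`. The pair `(i, n)` is the variable `x_n` of sort `i`. -/
def Letters {Γ : Type v} (X : Set (Γ × ℕ)) (i : Γ) : Type :=
  {n : ℕ // (i, n) ∈ X}

/-- The terms over the alphabet `X`; `Term S X i` is the set of the terms of sort `i`. -/
inductive Term {Γ : Type v} (S : Signature.{v, w} Γ) (X : Set (Γ × ℕ)) : Γ → Type (max v w)
  | var (i : Γ) (x : Letters X i) : Term S X i
  | app (ω : S.Op) (t : (j : Fin (S.arity ω)) → Term S X (S.dom ω j)) : Term S X (S.cod ω)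

/-- The value of a term in the algebra `A` under an assignment `φ` of the variables. -/
def Term.eval {Γ : Type v} {S : Signature.{v, w} Γ} {X : Set (Γ × ℕ)} (A : Alg.{u} S)
    (φ : (i : Γ) → Letters X i → A.carrier i) : (i : Γ) → Term S X i → A.carrier i
  | _, .var i x => φ i x
  | _, .app ω t => A.op ω (fun j => Term.eval A φ (S.dom ω j) (t j))

/-- An identity `lhs = rhs` between two terms of the same sort in finitely many variables. The set
of variables is recorded, because an identity holds vacuously in an algebra which has no elements
of the sort of one of these variables. -/
structure Identity {Γ : Type v} (S : Signature.{v, w} Γ) where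
  vars : Set (Γ × ℕ)
  finite_vars : vars.Finite
  sort : Γ
  lhs : Term S vars sort
  rhs : Term S vars sort

/-- The algebra `A` satisfies the identity `e`. -/
def Models {Γ : Type v} {S : Signature.{v, w} Γ} (A : Alg.{u} S) (e : Identity S) : Prop :=
  ∀ φ : (i : Γ) → Letters e.vars i → A.carrier i,
    Term.eval A φ e.sort e.lhs = Term.eval A φ e.sort e.rhs

/-- The class of all algebras that satisfy the set of identities `I`. -/
def Var {Γ : Type v} {S : Signature.{v, w} Γ} (I : Set (Identity S)) : Set (Alg.{u} S) :=
  {A | ∀ e ∈ I, Models A e}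

/-- The set of all identities that hold in all algebras of the class `Θ`. -/
def identitiesOf {Γ : Type v} {S : Signature.{v, w} Γ} (Θ : Set (Alg.{u} S)) :
    Set (Identity S) :=
  {e | ∀ A ∈ Θ, Models A e}

/-- A variety is a class of algebras defined by a set of identities. -/
def IsVariety {Γ : Type v} {S : Signature.{v, w} Γ} (Θ : Set (Alg.{u} S)) : Prop :=
  ∃ I : Set (Identity S), Θ = Var I

/-- The identity `x₁ = x₂` between two different variables of sort `i`. -/
def varsEq {Γ : Type v} (S : Signature.{v, w} Γ) (i : Γ) : Identity S where
  vars := {(i, 1), (i, 2)}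
  finite_vars := Set.toFinite _
  sort := i
  lhs := .var i ⟨1, Or.inl rfl⟩
  rhs := .var i ⟨2, Or.inr rfl⟩

/-- `Θ` is `i`-nondegenerate: the identity `x₁ = x₂` of sort `i` is not an identity of `Θ`. -/
def NondegenerateAt {Γ : Type v} {S : Signature.{v, w} Γ} (Θ : Set (Alg.{u} S)) (i : Γ) : Prop :=
  varsEq S i ∉ identitiesOf Θ

/-- `Θ` is nondegenerate: it is `i`-nondegenerate for every sort `i`. -/
def Nondegenerate {Γ : Type v} {S : Signature.{v, w} Γ} (Θ : Set (Alg.{u} S)) : Prop :=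
  ∀ i, NondegenerateAt Θ i

/-- `F` is a free algebra of `Θ` with the (many-sorted) set of free generators `Y ⊆ F`. -/
def IsFreeAlg {Γ : Type v} {S : Signature.{v, w} Γ} (Θ : Set (Alg.{u} S)) (F : Alg.{u} S)
    (Y : (i : Γ) → Set (F.carrier i)) : Prop :=
  F ∈ Θ ∧ ∀ H ∈ Θ, ∀ φ : (i : Γ) → Y i → H.carrier i,
    ∃! f : Hom F H, ∀ (i : Γ) (y : Y i), f.toFun i y = φ i y

/-- `Θ` is an `i`-IBN-variety: free generating sets of isomorphic free algebras of `Θ` have the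
same number of elements of sort `i`. -/
def IsIBNAt {Γ : Type v} {S : Signature.{v, w} Γ} (Θ : Set (Alg.{u} S)) (i : Γ) : Prop :=
  ∀ (F G : Alg.{u} S) (Y : (j : Γ) → Set (F.carrier j)) (Z : (j : Γ) → Set (G.carrier j)),
    IsFreeAlg Θ F Y → IsFreeAlg Θ G Z → Isomorphic F G →
      Cardinal.mk (Y i) = Cardinal.mk (Z i)

/-- `Θ` is an IBN-variety: it is an `i`-IBN-variety for every sort `i`. -/
def IsIBN {Γ : Type v} {S : Signature.{v, w} Γ} (Θ : Set (Alg.{u} S)) : Prop :=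
  ∀ i, IsIBNAt Θ i

/-! ### Two-sorted algebras with an action of the first sort on the second sort -/

/-- The names of sorts of a two-sorted algebra. -/
inductive TwoSorts : Type
  | first
  | second

/-- The two-sorted signature made of the operations of the one-sorted signature `S₁` on the first
sort, the operations of the one-sorted signature `S₂` on the second sort, and one binary
operation, the action, of type `(first, second; second)`. -/
abbrev actionSig (S₁ : Signature.{0, v} Unit) (S₂ : Signature.{0, w} Unit) :
    Signature.{0, max v w} TwoSorts where
  Op := S₁.Op ⊕ S₂.Op ⊕ Unit
  arity
    | .inl ω => S₁.arity ω
    | .inr (.inl ω) => S₂.arity ω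
    | .inr (.inr _) => 2
  dom
    | .inl _ => fun _ => .first
    | .inr (.inl _) => fun _ => .second
    | .inr (.inr _) => ![.first, .second]
  cod
    | .inl _ => .first
    | .inr _ => .second

section Action

variable {S₁ : Signature.{0, v} Unit} {S₂ : Signature.{0, w} Unit}

/-- The one-sorted algebra of the elements of the first sort. -/
abbrev Alg.firstPart (A : Alg.{u} (actionSig S₁ S₂)) : Alg.{u} S₁ where
  carrier _ := A.carrier .first
  op ω a := A.op (Sum.inl ω) a

/-- The one-sorted algebra of the elements of the second sort. -/
abbrev Alg.secondPart (A : Alg.{u} (actionSig S₁ S₂)) : Alg.{u} S₂ where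
  carrier _ := A.carrier .second
  op ω a := A.op (Sum.inr (Sum.inl ω)) a

/-- The action operation `g ∘ v`. -/
def Alg.act (A : Alg.{u} (actionSig S₁ S₂)) (g : A.carrier .first) (v : A.carrier .second) :
    A.carrier .second :=
  A.op (Sum.inr (Sum.inr ())) (Fin.cons g (Fin.cons v finZeroElim))

/-- The one-sorted variables from `X`, read as two-sorted variables of sort `s`. -/
def asSort (s : TwoSorts) (X : Set (Unit × ℕ)) : Set (TwoSorts × ℕ) :=
  {p | p.1 = s ∧ ((), p.2) ∈ X}

/-- A one-sorted term in the signature `S₁`, read as a two-sorted term of the first sort. -/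
def Term.inFirst (S₂ : Signature.{0, w} Unit) {X : Set (Unit × ℕ)} :
    {i : Unit} → Term S₁ X i → Term (actionSig S₁ S₂) (asSort .first X) .first
  | _, .var _ x => .var TwoSorts.first ⟨x.1, rfl, x.2⟩
  | _, .app ω t => .app (S := actionSig S₁ S₂) (Sum.inl ω) (fun j => Term.inFirst S₂ (t j))

/-- A one-sorted term in the signature `S₂`, read as a two-sorted term of the second sort. -/
def Term.inSecond (S₁ : Signature.{0, v} Unit) {X : Set (Unit × ℕ)} :
    {i : Unit} → Term S₂ X i → Term (actionSig S₁ S₂) (asSort .second X) .second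
  | _, .var _ x => .var TwoSorts.second ⟨x.1, rfl, x.2⟩
  | _, .app ω t =>
    .app (S := actionSig S₁ S₂) (Sum.inr (Sum.inl ω)) (fun j => Term.inSecond S₁ (t j))

theorem asSort_finite (s : TwoSorts) {X : Set (Unit × ℕ)} (hX : X.Finite) :
    (asSort s X).Finite := by
  refine (hX.image (fun p => (s, p.2))).subset ?_
  rintro ⟨a, n⟩ ⟨rfl, h⟩
  exact ⟨((), n), h, rfl⟩

/-- An identity of one-sorted `S₁`-algebras, read as an identity of two-sorted algebras. -/
def Identity.inFirst (S₂ : Signature.{0, w} Unit) (e : Identity S₁) :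
    Identity (actionSig S₁ S₂) where
  vars := asSort .first e.vars
  finite_vars := asSort_finite .first e.finite_vars
  sort := .first
  lhs := e.lhs.inFirst S₂
  rhs := e.rhs.inFirst S₂

/-- An identity of one-sorted `S₂`-algebras, read as an identity of two-sorted algebras. -/
def Identity.inSecond (S₁ : Signature.{0, v} Unit) (e : Identity S₂) :
    Identity (actionSig S₁ S₂) where
  vars := asSort .second e.vars
  finite_vars := asSort_finite .second e.finite_vars
  sort := .second
  lhs := e.lhs.inSecond S₁
  rhs := e.rhs.inSecond S₁

/-- The variety `Θ⁽¹⁾` of one-sorted algebras: it is defined by those identities of `Θ` that are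
identities between terms of the first sort. -/
def firstVariety (Θ : Set (Alg.{u} (actionSig S₁ S₂))) : Set (Alg.{u} S₁) :=
  Var {e | e.inFirst S₂ ∈ identitiesOf Θ}

/-- The variety `Θ⁽²⁾` of one-sorted algebras: it is defined by those identities of `Θ` that are
identities between terms in the operations and the variables of the second sort only. -/
def secondVariety (Θ : Set (Alg.{u} (actionSig S₁ S₂))) : Set (Alg.{u} S₂) :=
  Var {e | e.inSecond S₁ ∈ identitiesOf Θ}

/-- The identity `x ∘ y = y`, with `x` of the first and `y` of the second sort. -/
def trivialAction (S₁ : Signature.{0, v} Unit) (S₂ : Signature.{0, w} Unit) :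
    Identity (actionSig S₁ S₂) where
  vars := {(TwoSorts.first, 1), (TwoSorts.second, 1)}
  finite_vars := Set.toFinite _
  sort := .second
  lhs := .app (S := actionSig S₁ S₂) (Sum.inr (Sum.inr ()))
    (Fin.cons (.var TwoSorts.first ⟨1, Or.inl rfl⟩)
      (Fin.cons (.var TwoSorts.second ⟨1, Or.inr rfl⟩) finZeroElim))
  rhs := .var TwoSorts.second ⟨1, Or.inr rfl⟩

/-- The subvariety of `Θ` defined by the identity `x ∘ y = y`. -/
def trivialActionSubvariety (Θ : Set (Alg.{u} (actionSig S₁ S₂))) :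
    Set (Alg.{u} (actionSig S₁ S₂)) :=
  Θ ∩ Var {trivialAction S₁ S₂}

end Action

/-! ### Groups, vector spaces and representations of groups -/

/-- The operations of groups: multiplication, inverse, unit. -/
inductive GroupOp : Type
  | mul
  | inv
  | one

/-- The signature of groups. -/
abbrev groupSig : Signature.{0, 0} Unit where
  Op := GroupOp
  arity
    | .mul => 2
    | .inv => 1
    | .one => 0
  dom _ _ := ()
  cod _ := ()

/-- The operations of vector spaces over `k`: addition, negation, zero, and for every scalar one
unary operation. -/
inductive VectorOp (k : Type u) : Type u
  | add
  | neg
  | zero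
  | smul (c : k)

/-- The signature of vector spaces over `k`. -/
abbrev vectorSig (k : Type u) : Signature.{0, u} Unit where
  Op := VectorOp k
  arity
    | .add => 2
    | .neg => 1
    | .zero => 0
    | .smul _ => 1
  dom _ _ := ()
  cod _ := ()

/-- The signature of representations of groups over `k`. -/
abbrev repSig (k : Type u) : Signature.{0, u} TwoSorts :=
  actionSig groupSig (vectorSig k)

section Group

variable (A : Alg.{u} groupSig)

def gmul (x y : A.carrier ()) : A.carrier () := A.op GroupOp.mul ![x, y]

def ginv (x : A.carrier ()) : A.carrier () := A.op GroupOp.inv ![x]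

def gone : A.carrier () := A.op GroupOp.one (fun j => Fin.elim0 j)

end Group

/-- The class of all groups. -/
def groups : Set (Alg.{u} groupSig) :=
  {A | (∀ x y z, gmul A (gmul A x y) z = gmul A x (gmul A y z)) ∧
    (∀ x, gmul A (gone A) x = x) ∧ (∀ x, gmul A x (gone A) = x) ∧
    (∀ x, gmul A (ginv A x) x = gone A) ∧ (∀ x, gmul A x (ginv A x) = gone A)}

section Vector

variable {k : Type v} (A : Alg.{u} (vectorSig k))

def vadd (x y : A.carrier ()) : A.carrier () := A.op VectorOp.add ![x, y]

def vneg (x : A.carrier ()) : A.carrier () := A.op VectorOp.neg ![x]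

def vzero : A.carrier () := A.op VectorOp.zero (fun j => Fin.elim0 j)

def vsmul (c : k) (x : A.carrier ()) : A.carrier () := A.op (VectorOp.smul c) ![x]

end Vector

/-- The class of all vector spaces over `k`. -/
def vectorSpaces (k : Type v) [Field k] : Set (Alg.{u} (vectorSig k)) :=
  {A | (∀ x y z, vadd A (vadd A x y) z = vadd A x (vadd A y z)) ∧
    (∀ x y, vadd A x y = vadd A y x) ∧
    (∀ x, vadd A (vzero A) x = x) ∧ (∀ x, vadd A (vneg A x) x = vzero A) ∧
    (∀ (c : k) x y, vsmul A c (vadd A x y) = vadd A (vsmul A c x) (vsmul A c y)) ∧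
    (∀ (c d : k) x, vsmul A (c + d) x = vadd A (vsmul A c x) (vsmul A d x)) ∧
    (∀ (c d : k) x, vsmul A (c * d) x = vsmul A c (vsmul A d x)) ∧
    (∀ x, vsmul A (1 : k) x = x)}

/-- The class of all representations of groups over `k`: the first sort is a group, the second
sort is a vector space over `k`, and the group acts on the vector space by linear maps. -/
def groupReps (k : Type v) [Field k] : Set (Alg.{u} (repSig k)) :=
  {A | A.firstPart ∈ groups ∧ A.secondPart ∈ vectorSpaces k ∧
    (∀ v, A.act (gone A.firstPart) v = v) ∧
    (∀ g h v, A.act (gmul A.firstPart g h) v = A.act g (A.act h v)) ∧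
    (∀ g v w, A.act g (vadd A.secondPart v w) = vadd A.secondPart (A.act g v) (A.act g w)) ∧
    (∀ g (c : k) v, A.act g (vsmul A.secondPart c v) = vsmul A.secondPart c (A.act g v))}

end ManySorted

/-! The invariant basis number is detected on members of the variety that are free modules in one
sort and trivial in the other. Suppose that `Θ` contains, for each set `X`, an algebra with the free
`R`-module on `X` in sort `i` and one point in every other sort, where `R` is a nontrivial
commutative ring and linear maps give homomorphisms. If `F` is free on `Y`, every homomorphism from
`F` to such an algebra factors, by uniqueness of extensions from `Y`, through the one sending the
generators of sort `i` to the standard basis of the free module on `Y i`. An isomorphism of free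
algebras thus induces an isomorphism of these modules, and `R` has invariant basis number
(`isIBNAt_of_freeModules`).

The test algebras lie in `Θ` because a variety is closed under subalgebras of products
(`mem_of_separating`). In sort 2 they are vector spaces under the trivial group, separated by linear
functionals followed by the inclusion of a line of a representation in `Θ`. In sort 1 they are free
modules over `ZMod n` acting on the zero space, separated by coordinates followed by the embedding
of a nontrivial cyclic subgroup of a group in `Θ`.

The same algebras settle the derived varieties: the group parts of the second kind lie in
`firstVariety Θ`, and the first kind satisfies the identity of trivial action, so it puts every
vector space in `Δ⁽²⁾`. The reverse inclusions hold since the axioms of groups and vector spaces are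
identities. -/

namespace ManySorted

/-! ### Separation by homomorphisms and a criterion for invariant basis number -/

section General

variable {Γ : Type v} {S : Signature.{v, w} Γ}

/-- The composition of two homomorphisms. -/
def Hom.comp {A B C : Alg.{u} S} (g : Hom B C) (f : Hom A B) : Hom A C where
  toFun i a := g.toFun i (f.toFun i a)
  map_op ω a := by rw [f.map_op, g.map_op]

theorem Hom.map_eval {A B : Alg.{u} S} (f : Hom A B) {X : Set (Γ × ℕ)}
    (φ : (i : Γ) → Letters X i → A.carrier i) {i : Γ} (t : Term S X i) :
    f.toFun i (t.eval A φ) = t.eval B (fun j x => f.toFun j (φ j x)) := by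
  induction t with
  | var i x => rfl
  | app ω t ih =>
    simp only [Term.eval, f.map_op]
    congr 1
    funext j
    exact ih j

/-- A variety contains every algebra whose points are separated by homomorphisms to members of
the variety. -/
theorem mem_of_separating {Θ : Set (Alg.{u} S)} (hΘ : IsVariety Θ) {B : Alg.{u} S}
    (hsep : ∀ (i : Γ) (a b : B.carrier i),
      (∀ A ∈ Θ, ∀ f : Hom B A, f.toFun i a = f.toFun i b) → a = b) : B ∈ Θ := by
  obtain ⟨I, rfl⟩ := hΘ
  intro e he φ
  -- Homomorphisms commute with evaluation, so each one into a member of the variety identifies the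
  -- two sides.
  refine hsep _ _ _ fun A hA f => ?_
  rw [f.map_eval, f.map_eval]
  exact hA e he _

/-- A homomorphism that is bijective on every sort has an inverse. -/
theorem Hom.exists_inverse {A B : Alg.{u} S} (f : Hom A B)
    (hf : ∀ i, Function.Bijective (f.toFun i)) :
    ∃ g : Hom B A, (∀ i a, g.toFun i (f.toFun i a) = a) ∧ ∀ i b, f.toFun i (g.toFun i b) = b := by
  choose g hgf hfg using fun i => Function.bijective_iff_has_inverse.1 (hf i)
  refine ⟨⟨g, fun ω b => (hf _).1 ?_⟩, hgf, hfg⟩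
  rw [hfg, f.map_op]
  congr 1
  funext j
  exact (hfg _ _).symm

open Classical in
/-- If `Θ` contains algebras `H X` that are trivial except in sort `i`, where they are free
`R`-modules on `X`, in such a way that linear maps are homomorphisms, then `Θ` is an
`i`-IBN-variety. -/
theorem isIBNAt_of_freeModules {Θ : Set (Alg.{u} S)} {i : Γ} {R : Type*} [CommRing R]
    [Nontrivial R] (H : Type u → Alg.{u} S) (hH : ∀ X, H X ∈ Θ)
    (e : ∀ X, (H X).carrier i ≃ (X →₀ R)) (pt : ∀ X j, (H X).carrier j)
    (hpt : ∀ X j, j ≠ i → ∀ a : (H X).carrier j, a = pt X j)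
    (hmap : ∀ (X X' : Type u) (l : (X →₀ R) →ₗ[R] (X' →₀ R)),
      ∃ g : Hom (H X) (H X'), ∀ a, e X' (g.toFun i a) = l (e X a)) : IsIBNAt Θ i := by
  intro F G Y Z hF hG ⟨a, ha⟩
  obtain ⟨b, hba, hab⟩ := a.exists_inverse ha
  -- Generators of sort `i` go to the standard basis; those of other sorts have only one possible
  -- image.
  have canon : ∀ (F : Alg.{u} S) (Y : (j : Γ) → Set (F.carrier j)), IsFreeAlg Θ F Y →
      ∃ f : Hom F (H (Y i)), ∀ y : Y i, e _ (f.toFun i y) = Finsupp.single y 1 := by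
    intro F Y hF
    obtain ⟨f, hf, -⟩ := hF.2 (H (Y i)) (hH _) (fun j y =>
      if h : j = i then (e (Y i)).symm (Finsupp.single ⟨h ▸ y.1, by subst h; exact y.2⟩ 1) |>
        fun z => h.symm ▸ z else pt _ j)
    exact ⟨f, fun y => by rw [hf i y]; simp⟩
  obtain ⟨f, hf⟩ := canon F Y hF
  obtain ⟨g, hg⟩ := canon G Z hG
  have factor : ∀ (F : Alg.{u} S) (Y : (j : Γ) → Set (F.carrier j)), IsFreeAlg Θ F Y →
      -- On sort `i`, `h` is `f` followed by the linear map that has the prescribed values on the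
      -- basis; both composites agree on `Y`.
      ∀ f : Hom F (H (Y i)), (∀ y : Y i, e _ (f.toFun i y) = Finsupp.single y 1) →
      ∀ (X : Type u) (h : Hom F (H X)) (x : F.carrier i),
        Finsupp.linearCombination R (fun y : Y i => e X (h.toFun i y)) (e _ (f.toFun i x)) =
          e X (h.toFun i x) := by
    intro F Y hF f hf X h x
    obtain ⟨l, hl⟩ := hmap _ _ (Finsupp.linearCombination R (fun y : Y i => e X (h.toFun i y)))
    rw [← hl]
    congr 1
    have := (hF.2 (H X) (hH X) (fun j y => h.toFun j y)).unique (y₁ := l.comp f) (y₂ := h) ?_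
      (fun _ _ => rfl)
    · rw [← this]; rfl
    · intro j y
      by_cases hj : j = i
      · subst hj
        apply (e X).injective
        change e X (l.toFun _ (f.toFun _ y)) = _
        rw [hl, hf]
        simp
      · rw [hpt _ _ hj (h.toFun j y)]
        exact hpt _ _ hj _
  -- Both index sets are bases of one module: the standard basis for `Z i` is carried over by the
  -- linear maps that `a` and `b` induce.
  refine Cardinal.lift_injective.{u, u} (mk_eq_mk_of_basis (R := R) (M := Y i →₀ R) Finsupp.basisSingleOne
    (Finsupp.basisSingleOne.map (LinearEquiv.ofLinearMap
      (Finsupp.linearCombination R (fun z : Z i => e _ ((f.comp b).toFun i z)))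
      (Finsupp.linearCombination R (fun y : Y i => e _ ((g.comp a).toFun i y))) ?_ ?_)))
  · ext1 y
    ext1
    simp only [LinearMap.comp_apply, Finsupp.lsingle_apply, Finsupp.linearCombination_single,
      one_smul, LinearMap.id_apply]
    rw [show (g.comp a).toFun i y = g.toFun i (a.toFun i y) from rfl, factor G Z hG g hg,
      ← hf y]
    exact congrArg (fun c => e _ (f.toFun i c)) (hba _ _)
  · ext1 z
    ext1
    simp only [LinearMap.comp_apply, Finsupp.lsingle_apply, Finsupp.linearCombination_single,
      one_smul, LinearMap.id_apply]
    rw [show (f.comp b).toFun i z = f.toFun i (b.toFun i z) from rfl, factor F Y hF f hf,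
      ← hg z]
    exact congrArg (fun c => e _ (g.toFun i c)) (hab _ _)

end General

/-! ### One-sorted identities inside two-sorted algebras -/

section Action

variable {S₁ : Signature.{0, v} Unit} {S₂ : Signature.{0, w} Unit}

theorem Term.eval_inFirst (A : Alg.{u} (actionSig S₁ S₂)) {X : Set (Unit × ℕ)}
    (φ : (i : TwoSorts) → Letters (asSort .first X) i → A.carrier i) {i : Unit}
    (t : Term S₁ X i) :
    Term.eval A φ .first (t.inFirst S₂) =
      Term.eval A.firstPart (fun _ x => φ .first ⟨x.1, rfl, x.2⟩) i t := by
  induction t with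
  | var i x => rfl
  | app ω t ih => exact congrArg (A.op (Sum.inl ω)) (funext fun j => ih j)

theorem Term.eval_inSecond (A : Alg.{u} (actionSig S₁ S₂)) {X : Set (Unit × ℕ)}
    (φ : (i : TwoSorts) → Letters (asSort .second X) i → A.carrier i) {i : Unit}
    (t : Term S₂ X i) :
    Term.eval A φ .second (t.inSecond S₁) =
      Term.eval A.secondPart (fun _ x => φ .second ⟨x.1, rfl, x.2⟩) i t := by
  induction t with
  | var i x => rfl
  | app ω t ih => exact congrArg (A.op (Sum.inr (Sum.inl ω))) (funext fun j => ih j)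

theorem models_inFirst (A : Alg.{u} (actionSig S₁ S₂)) (e : Identity S₁) :
    Models A (e.inFirst S₂) ↔ Models A.firstPart e := by
  constructor
  · intro h φ
    have := h fun i x => match i, x with
      | .first, x => φ () ⟨x.1, x.2.2⟩
      | .second, x => nomatch x.2.1
    exact (Term.eval_inFirst A _ e.lhs).symm.trans (this.trans (Term.eval_inFirst A _ e.rhs))
  · intro h φ
    exact (Term.eval_inFirst A _ e.lhs).trans ((h _).trans (Term.eval_inFirst A _ e.rhs).symm)

theorem models_inSecond (A : Alg.{u} (actionSig S₁ S₂)) (e : Identity S₂) :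
    Models A (e.inSecond S₁) ↔ Models A.secondPart e := by
  constructor
  · intro h φ
    have := h fun i x => match i, x with
      | .first, x => nomatch x.2.1
      | .second, x => φ () ⟨x.1, x.2.2⟩
    exact (Term.eval_inSecond A _ e.lhs).symm.trans (this.trans (Term.eval_inSecond A _ e.rhs))
  · intro h φ
    exact (Term.eval_inSecond A _ e.lhs).trans ((h _).trans (Term.eval_inSecond A _ e.rhs).symm)

theorem firstPart_mem_firstVariety {Θ : Set (Alg.{u} (actionSig S₁ S₂))}
    {A : Alg.{u} (actionSig S₁ S₂)} (hA : A ∈ Θ) : A.firstPart ∈ firstVariety Θ :=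
  fun e he => (models_inFirst A e).1 (he A hA)

theorem secondPart_mem_secondVariety {Θ : Set (Alg.{u} (actionSig S₁ S₂))}
    {A : Alg.{u} (actionSig S₁ S₂)} (hA : A ∈ Θ) : A.secondPart ∈ secondVariety Θ :=
  fun e he => (models_inSecond A e).1 (he A hA)

theorem models_trivialAction (A : Alg.{u} (actionSig S₁ S₂)) :
    Models A (trivialAction S₁ S₂) ↔ ∀ g v, A.act g v = v := by
  have key : ∀ φ : (i : TwoSorts) → Letters (trivialAction S₁ S₂).vars i → A.carrier i,
      Term.eval A φ _ (trivialAction S₁ S₂).lhs =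
        A.act (φ .first ⟨1, Or.inl rfl⟩) (φ .second ⟨1, Or.inr rfl⟩) := by
    intro φ
    refine congrArg (A.op (Sum.inr (Sum.inr ()))) (funext fun j => ?_)
    match j with
    | 0 => rfl
    | 1 => rfl
  constructor
  · intro h g v
    have := h fun i _ => match i with
      | .first => g
      | .second => v
    rwa [key] at this
  · intro h φ
    rw [key, h]
    rfl

end Action

/-- Only variables of sort `i` occur in the identity, so the values at other sorts are mere
defaults, supplied by nonemptiness. -/
theorem nondegenerateAt_iff {Γ : Type v} {S : Signature.{v, w} Γ} {Θ : Set (Alg.{u} S)} {i : Γ}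
    (hΘ : ∀ A ∈ Θ, ∀ j, Nonempty (A.carrier j)) :
    NondegenerateAt Θ i ↔ ∃ A ∈ Θ, ∃ a b : A.carrier i, a ≠ b := by
  classical
  constructor
  · intro h
    simp only [NondegenerateAt, identitiesOf, Set.mem_ofPred_eq, not_forall, Models] at h
    obtain ⟨A, hA, φ, hφ⟩ := h
    exact ⟨A, hA, _, _, hφ⟩
  · rintro ⟨A, hA, a, b, hab⟩ h
    let pt := fun j => (hΘ A hA j).some
    refine hab ?_
    have := h A hA fun j x => if hj : j = i then
      (if x.1 = 1 then hj.symm ▸ a else hj.symm ▸ b) else pt j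
    simpa [varsEq, Term.eval] using this

/-! ### Trivial representations and their membership in the variety -/

section Groups

/-- The group structure on an algebra from the class of all groups. -/
abbrev groupOf {A : Alg.{u} groupSig} (hA : A ∈ groups) : Group (A.carrier ()) where
  mul := gmul A
  inv := ginv A
  one := gone A
  mul_assoc := hA.1
  one_mul := hA.2.1
  mul_one := hA.2.2.1
  inv_mul_cancel := hA.2.2.2.1

/-- The additive group structure on an algebra from the class of all vector spaces. -/
abbrev addCommGroupOf {k : Type v} [Field k] {A : Alg.{u} (vectorSig k)}
    (hA : A ∈ vectorSpaces k) : AddCommGroup (A.carrier ()) where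
  add := vadd A
  neg := vneg A
  zero := vzero A
  add_assoc := hA.1
  add_comm := hA.2.1
  zero_add := hA.2.2.1
  add_zero x := (hA.2.1 x _).trans (hA.2.2.1 x)
  neg_add_cancel := hA.2.2.2.1
  nsmul := @nsmulRec _ ⟨vzero A⟩ ⟨vadd A⟩
  zsmul := @zsmulRec _ ⟨vzero A⟩ ⟨vadd A⟩ ⟨vneg A⟩ (@nsmulRec _ ⟨vzero A⟩ ⟨vadd A⟩)

/-- The vector space structure on an algebra from the class of all vector spaces. -/
abbrev moduleOf {k : Type v} [Field k] {A : Alg.{u} (vectorSig k)} (hA : A ∈ vectorSpaces k) :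
    @Module k (A.carrier ()) _ (addCommGroupOf hA).toAddCommMonoid :=
  letI := addCommGroupOf hA
  letI : SMul k (A.carrier ()) := ⟨vsmul A⟩
  Module.ofMinimalAxioms hA.2.2.2.2.1 hA.2.2.2.2.2.1 hA.2.2.2.2.2.2.1 hA.2.2.2.2.2.2.2

/-- The representation of the group `G` on the vector space `V` by the trivial action. -/
def trivialRep (k : Type u) [Field k] (G V : Type u) [Group G] [AddCommGroup V] [Module k V] :
    Alg.{u} (repSig k) where
  carrier
    | .first => G
    | .second => V
  op
    | .inl .mul => fun a => show G from (show G from a (0 : Fin 2)) * (show G from a (1 : Fin 2))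
    | .inl .inv => fun a => show G from (show G from a (0 : Fin 1))⁻¹
    | .inl .one => fun _ => (1 : G)
    | .inr (.inl .add) => fun a =>
      show V from (show V from a (0 : Fin 2)) + (show V from a (1 : Fin 2))
    | .inr (.inl .neg) => fun a => show V from -(show V from a (0 : Fin 1))
    | .inr (.inl .zero) => fun _ => (0 : V)
    | .inr (.inl (.smul c)) => fun a => show V from c • (show V from a (0 : Fin 1))
    | .inr (.inr ()) => fun a => a (1 : Fin 2)

variable {k : Type u} [Field k]

/-- Homomorphisms from a trivial representation, from their components. -/
def trivialRepHom {G V : Type u} [Group G] [AddCommGroup V] [Module k V]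
    {A : Alg.{u} (repSig k)} (hA : A ∈ groupReps k)
    (φ : letI := groupOf hA.1; G →* A.carrier .first)
    (ψ : letI := addCommGroupOf hA.2.1; letI := moduleOf hA.2.1; V →ₗ[k] A.carrier .second)
    (hact : ∀ g v, A.act (φ g) (ψ v) = ψ v) : Hom (trivialRep k G V) A :=
  letI := groupOf hA.1
  letI := addCommGroupOf hA.2.1
  letI := moduleOf hA.2.1
  { toFun := fun
      | .first => φ
      | .second => ψ
    map_op := fun
      | .inl .mul, _ => (map_mul φ _ _).trans <| congrArg (A.op (Sum.inl GroupOp.mul)) <|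
          funext fun j => match j with | (0 : Fin 2) => rfl | (1 : Fin 2) => rfl
      | .inl .inv, _ => (map_inv φ _).trans <| congrArg (A.op (Sum.inl GroupOp.inv)) <|
          funext fun j => match j with | (0 : Fin 1) => rfl
      | .inl .one, _ => (map_one φ).trans <| congrArg (A.op (Sum.inl GroupOp.one)) <|
          funext fun j => Fin.elim0 j
      | .inr (.inl .add), _ => (map_add ψ _ _).trans <|
          congrArg (A.op (Sum.inr (Sum.inl VectorOp.add))) <|
          funext fun j => match j with | (0 : Fin 2) => rfl | (1 : Fin 2) => rfl
      | .inr (.inl .neg), _ => (map_neg ψ _).trans <|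
          congrArg (A.op (Sum.inr (Sum.inl VectorOp.neg))) <|
          funext fun j => match j with | (0 : Fin 1) => rfl
      | .inr (.inl .zero), _ => (map_zero ψ).trans <|
          congrArg (A.op (Sum.inr (Sum.inl VectorOp.zero))) <| funext fun j => Fin.elim0 j
      | .inr (.inl (.smul c)), _ => (map_smul ψ c _).trans <|
          congrArg (A.op (Sum.inr (Sum.inl (VectorOp.smul c)))) <|
          funext fun j => match j with | (0 : Fin 1) => rfl
      | .inr (.inr ()), a => (hact (a (0 : Fin 2)) (a (1 : Fin 2))).symm.trans <|
          congrArg (A.op (Sum.inr (Sum.inr ()))) <|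
          funext fun j => match j with | (0 : Fin 2) => rfl | (1 : Fin 2) => rfl }

/-- A group homomorphism and a linear map form a homomorphism of trivial representations. -/
def trivialRepMap {G V G' V' : Type u} [Group G] [AddCommGroup V] [Module k V] [Group G']
    [AddCommGroup V'] [Module k V'] (φ : G →* G') (ψ : V →ₗ[k] V') :
    Hom (trivialRep k G V) (trivialRep k G' V') where
  toFun
    | .first => φ
    | .second => ψ
  map_op
    | .inl .mul, _ => map_mul φ _ _
    | .inl .inv, _ => map_inv φ _
    | .inl .one, _ => map_one φ
    | .inr (.inl .add), _ => map_add ψ _ _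
    | .inr (.inl .neg), _ => map_neg ψ _
    | .inr (.inl .zero), _ => map_zero ψ
    | .inr (.inl (.smul c)), _ => map_smul ψ c _
    | .inr (.inr ()), _ => rfl

variable {Θ : Set (Alg.{u} (repSig k))}

/-- The zero vector is its own multiple by the scalar 0, and the action commutes with scalars. Hence
any group homomorphism paired with the zero linear map is compatible with the actions. -/
theorem act_zero {A : Alg.{u} (repSig k)} (hA : A ∈ groupReps k) (g : A.carrier .first) :
    A.act g (vzero A.secondPart) = vzero A.secondPart := by
  let := addCommGroupOf hA.2.1
  let := moduleOf hA.2.1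
  have h : ∀ v : A.carrier .second, vsmul A.secondPart (0 : k) v = vzero A.secondPart :=
    fun v => zero_smul k v
  have := hA.2.2.2.2.2 g 0 (vzero A.secondPart)
  rwa [h, h] at this

/-- A nondegenerate variety contains the trivial representation on every vector space. -/
theorem trivialRep_punit_left_mem (hvar : IsVariety Θ) (hrep : Θ ⊆ groupReps k)
    {A : Alg.{u} (repSig k)} (hA : A ∈ Θ) {a b : A.carrier .second} (hab : a ≠ b)
    (V : Type u) [AddCommGroup V] [Module k V] : trivialRep k PUnit V ∈ Θ := by
  have hA' := hrep hA
  let := groupOf hA'.1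
  let := addCommGroupOf hA'.2.1
  let := moduleOf hA'.2.1
  refine mem_of_separating hvar fun i x y h => ?_
  match i with
  | .first => rfl
  | .second =>
    change V at x y
    change (show V from x) = y
    -- Functionals separate points of `V`; each yields a homomorphism to `A` with values in the line
    -- through `a - b ≠ 0`.
    rw [← sub_eq_zero, ← Module.forall_dual_apply_eq_zero_iff k]
    intro f
    have := h A hA (trivialRepHom hA' 1 (f.smulRight (show A.carrier .second from a - b))
      fun _ v => hA'.2.2.1 _)
    change f x • (a - b) = f y • (a - b) at this
    rw [map_sub]
    have h2 : (f x - f y) • (a - b) = 0 := by rw [sub_smul, this, sub_self]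
    exact (smul_eq_zero.1 h2).resolve_right (sub_ne_zero.2 hab)

/-- This is the cyclic subgroup generated by `g`. Infinite order gives `n = 0`, that is ℤ, and `g ≠
1` excludes `n = 1`, the only trivial case. -/
theorem exists_injective_zmod {G : Type u} [Group G] {g : G} (hg : g ≠ 1) :
    ∃ n : ℕ, Nontrivial (ZMod n) ∧ ∃ l : ZMod n →+ Additive G, Function.Injective l := by
  refine ⟨orderOf g, ZMod.nontrivial_iff.2 (by simpa using hg),
    ZMod.lift _ ⟨zmultiplesHom _ (Additive.ofMul g), ?_⟩, (ZMod.lift_injective _).2 fun m hm => ?_⟩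
  · simp [← ofMul_pow, pow_orderOf_eq_one]
  · rw [ZMod.intCast_zmod_eq_zero_iff_dvd, orderOf_dvd_iff_zpow_eq_one]
    simpa [← ofMul_zpow] using hm

/-- A nondegenerate variety contains the free modules over `ℤ / n` for some `n ≠ 1`, as groups
that act on the zero space. -/
theorem exists_trivialRep_punit_right_mem (hvar : IsVariety Θ) (hrep : Θ ⊆ groupReps k)
    {A : Alg.{u} (repSig k)} (hA : A ∈ Θ) {a b : A.carrier .first} (hab : a ≠ b) :
    ∃ n : ℕ, Nontrivial (ZMod n) ∧
      ∀ X : Type u, trivialRep k (Multiplicative (X →₀ ZMod n)) PUnit ∈ Θ := by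
  have hA' := hrep hA
  let := groupOf hA'.1
  let := addCommGroupOf hA'.2.1
  let := moduleOf hA'.2.1
  obtain ⟨n, hn, l, hl⟩ := exists_injective_zmod (mt mul_inv_eq_one.1 hab)
  refine ⟨n, hn, fun X => ?_⟩
  refine mem_of_separating hvar fun i x y h => ?_
  match i with
  | .second => rfl
  | .first =>
    change Multiplicative (X →₀ ZMod _) at x y
    apply Multiplicative.toAdd.injective
    ext1 t
    refine hl ?_
    -- The coordinate at `t` followed by `l`, with zero linear part, so that the action of the image
    -- is irrelevant.
    exact h A hA (trivialRepHom hA'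
      (AddMonoidHom.toMultiplicativeLeft (l.comp (Finsupp.applyAddHom t))) 0
      fun g _ => act_zero hA' _)

end Groups

/-! ### The axioms of groups and vector spaces as identities -/

section Axioms

variable {S : Signature.{0, w} Unit}

/-- The set of the variables number `0`, `1` and `2`. -/
abbrev threeVars : Set (Unit × ℕ) := {p | p.2 < 3}

theorem threeVars_finite : threeVars.Finite := by
  refine ((Set.finite_lt_nat 3).image (fun n => ((), n))).subset ?_
  rintro ⟨⟨⟩, n⟩ h
  exact ⟨n, h, rfl⟩

/-- The variable number `n`, as a term. -/
abbrev threeVar (S : Signature.{0, w} Unit) (n : Fin 3) : Term S threeVars () :=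
  .var () ⟨n.1, n.2⟩

/-- The assignment of the elements `x`, `y`, `z` to the variables `0`, `1` and `2`. -/
abbrev threeAssign (B : Alg.{u} S) (x y z : B.carrier ()) (i : Unit)
    (a : Letters threeVars i) : B.carrier i :=
  (![x, y, z] : Fin 3 → B.carrier ()) ⟨a.1, a.2⟩

/-- A universally quantified equation between terms in three variables. -/
theorem eval_eq_of_mem_var {P : Identity S → Prop} {B : Alg.{u} S} (hB : B ∈ Var {e | P e})
    (s t : Term S threeVars ()) (h : P ⟨threeVars, threeVars_finite, (), s, t⟩)
    (x y z : B.carrier ()) :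
    s.eval B (threeAssign B x y z) = t.eval B (threeAssign B x y z) :=
  hB _ h _

variable {X : Set (Unit × ℕ)}

abbrev Term.gmul (s t : Term groupSig X ()) : Term groupSig X () :=
  .app (S := groupSig) GroupOp.mul ![s, t]

abbrev Term.ginv (s : Term groupSig X ()) : Term groupSig X () :=
  .app (S := groupSig) GroupOp.inv ![s]

abbrev Term.gone : Term groupSig X () :=
  .app (S := groupSig) GroupOp.one (fun j => Fin.elim0 j)

section

variable (A : Alg.{u} groupSig) (φ : (i : Unit) → Letters X i → A.carrier i)

theorem Term.eval_gmul (s t : Term groupSig X ()) :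
    (s.gmul t).eval A φ = ManySorted.gmul A (s.eval A φ) (t.eval A φ) :=
  congrArg (A.op GroupOp.mul) <| funext fun j => match j with
    | (0 : Fin 2) => rfl
    | (1 : Fin 2) => rfl

theorem Term.eval_ginv (s : Term groupSig X ()) :
    s.ginv.eval A φ = ManySorted.ginv A (s.eval A φ) :=
  congrArg (A.op GroupOp.inv) <| funext fun j => match j with
    | (0 : Fin 1) => rfl

theorem Term.eval_gone : (Term.gone (X := X)).eval A φ = ManySorted.gone A :=
  congrArg (A.op GroupOp.one) <| funext fun j => Fin.elim0 j

end

variable {k : Type v}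

abbrev Term.vadd (s t : Term (vectorSig k) X ()) : Term (vectorSig k) X () :=
  .app (S := vectorSig k) VectorOp.add ![s, t]

abbrev Term.vneg (s : Term (vectorSig k) X ()) : Term (vectorSig k) X () :=
  .app (S := vectorSig k) VectorOp.neg ![s]

abbrev Term.vzero : Term (vectorSig k) X () :=
  .app (S := vectorSig k) VectorOp.zero (fun j => Fin.elim0 j)

abbrev Term.vsmul (c : k) (s : Term (vectorSig k) X ()) : Term (vectorSig k) X () :=
  .app (S := vectorSig k) (VectorOp.smul c) ![s]

section

variable (A : Alg.{u} (vectorSig k)) (φ : (i : Unit) → Letters X i → A.carrier i)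

theorem Term.eval_vadd (s t : Term (vectorSig k) X ()) :
    (s.vadd t).eval A φ = ManySorted.vadd A (s.eval A φ) (t.eval A φ) :=
  congrArg (A.op VectorOp.add) <| funext fun j => match j with
    | (0 : Fin 2) => rfl
    | (1 : Fin 2) => rfl

theorem Term.eval_vneg (s : Term (vectorSig k) X ()) :
    s.vneg.eval A φ = ManySorted.vneg A (s.eval A φ) :=
  congrArg (A.op VectorOp.neg) <| funext fun j => match j with
    | (0 : Fin 1) => rfl

theorem Term.eval_vzero : (Term.vzero (X := X)).eval A φ = ManySorted.vzero A :=
  congrArg (A.op VectorOp.zero) <| funext fun j => Fin.elim0 j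

theorem Term.eval_vsmul (c : k) (s : Term (vectorSig k) X ()) :
    (s.vsmul c).eval A φ = ManySorted.vsmul A c (s.eval A φ) :=
  congrArg (A.op (VectorOp.smul c)) <| funext fun j => match j with
    | (0 : Fin 1) => rfl

end

/-- A variety whose identities include all identities of groups consists of groups. -/
theorem var_subset_groups {P : Identity groupSig → Prop}
    (hP : ∀ e, (∀ A ∈ (groups : Set (Alg.{u} groupSig)), Models A e) → P e) :
    (Var {e | P e} : Set (Alg.{u} groupSig)) ⊆ groups := by
  intro B hB
  have key := fun s t h => eval_eq_of_mem_var hB s t (hP _ h)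
  let X := threeVar groupSig 0
  let Y := threeVar groupSig 1
  let Z := threeVar groupSig 2
  refine ⟨fun x y z => ?_, fun x => ?_, fun x => ?_, fun x => ?_, fun x => ?_⟩
  · have := key ((X.gmul Y).gmul Z) (X.gmul (Y.gmul Z)) (fun A hA φ => by
      simp only [Term.eval_gmul]; exact hA.1 _ _ _) x y z
    simp only [Term.eval_gmul] at this
    exact this
  -- Variables 1 and 2 do not occur, so their value is arbitrary.
  · have := key (Term.gone.gmul X) X (fun A hA φ => by
      simp only [Term.eval_gmul, Term.eval_gone]; exact hA.2.1 _) x x x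
    simp only [Term.eval_gmul, Term.eval_gone] at this
    exact this
  · have := key (X.gmul Term.gone) X (fun A hA φ => by
      simp only [Term.eval_gmul, Term.eval_gone]; exact hA.2.2.1 _) x x x
    simp only [Term.eval_gmul, Term.eval_gone] at this
    exact this
  · have := key (X.ginv.gmul X) Term.gone (fun A hA φ => by
      simp only [Term.eval_gmul, Term.eval_gone, Term.eval_ginv]; exact hA.2.2.2.1 _) x x x
    simp only [Term.eval_gmul, Term.eval_gone, Term.eval_ginv] at this
    exact this
  · have := key (X.gmul X.ginv) Term.gone (fun A hA φ => by
      simp only [Term.eval_gmul, Term.eval_gone, Term.eval_ginv]; exact hA.2.2.2.2 _) x x x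
    simp only [Term.eval_gmul, Term.eval_gone, Term.eval_ginv] at this
    exact this

/-- A variety whose identities include all identities of vector spaces consists of vector
spaces. -/
theorem var_subset_vectorSpaces [Field k] {P : Identity (vectorSig k) → Prop}
    (hP : ∀ e, (∀ A ∈ (vectorSpaces k : Set (Alg.{u} (vectorSig k))), Models A e) → P e) :
    (Var {e | P e} : Set (Alg.{u} (vectorSig k))) ⊆ vectorSpaces k := by
  intro B hB
  have key := fun s t h => eval_eq_of_mem_var hB s t (hP _ h)
  let X := threeVar (vectorSig k) 0
  let Y := threeVar (vectorSig k) 1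
  let Z := threeVar (vectorSig k) 2
  refine ⟨fun x y z => ?_, fun x y => ?_, fun x => ?_, fun x => ?_, fun c x y => ?_,
    fun c d x => ?_, fun c d x => ?_, fun x => ?_⟩
  · have := key ((X.vadd Y).vadd Z) (X.vadd (Y.vadd Z)) (fun A hA φ => by
      simp only [Term.eval_vadd]; exact hA.1 _ _ _) x y z
    simp only [Term.eval_vadd] at this
    exact this
  · have := key (X.vadd Y) (Y.vadd X) (fun A hA φ => by
      simp only [Term.eval_vadd]; exact hA.2.1 _ _) x y y
    simp only [Term.eval_vadd] at this
    exact this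
  · have := key (Term.vzero.vadd X) X (fun A hA φ => by
      simp only [Term.eval_vadd, Term.eval_vzero]; exact hA.2.2.1 _) x x x
    simp only [Term.eval_vadd, Term.eval_vzero] at this
    exact this
  · have := key (X.vneg.vadd X) Term.vzero (fun A hA φ => by
      simp only [Term.eval_vadd, Term.eval_vzero, Term.eval_vneg]; exact hA.2.2.2.1 _) x x x
    simp only [Term.eval_vadd, Term.eval_vzero, Term.eval_vneg] at this
    exact this
  · have := key ((X.vadd Y).vsmul c) ((X.vsmul c).vadd (Y.vsmul c)) (fun A hA φ => by
      simp only [Term.eval_vadd, Term.eval_vsmul]; exact hA.2.2.2.2.1 _ _ _) x y y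
    simp only [Term.eval_vadd, Term.eval_vsmul] at this
    exact this
  · have := key (X.vsmul (c + d)) ((X.vsmul c).vadd (X.vsmul d)) (fun A hA φ => by
      simp only [Term.eval_vadd, Term.eval_vsmul]; exact hA.2.2.2.2.2.1 _ _ _) x x x
    simp only [Term.eval_vadd, Term.eval_vsmul] at this
    exact this
  · have := key (X.vsmul (c * d)) ((X.vsmul d).vsmul c) (fun A hA φ => by
      simp only [Term.eval_vsmul]; exact hA.2.2.2.2.2.2.1 _ _ _) x x x
    simp only [Term.eval_vsmul] at this
    exact this
  · have := key (X.vsmul 1) X (fun A hA φ => by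
      simp only [Term.eval_vsmul]; exact hA.2.2.2.2.2.2.2 _) x x x
    simp only [Term.eval_vsmul] at this
    exact this

end Axioms

/-! ### Invariant basis number for each sort, and the derived varieties -/

theorem nonempty_carrier {k : Type u} {A : Alg.{u} (repSig k)} :
    ∀ j, Nonempty (A.carrier j)
  | .first => ⟨gone A.firstPart⟩
  | .second => ⟨vzero A.secondPart⟩

variable {k : Type u} [Field k]

theorem isIBNAt_second {Θ : Set (Alg.{u} (repSig k))}
    (hΘ : ∀ (V : Type u) [AddCommGroup V] [Module k V], trivialRep k PUnit V ∈ Θ) :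
    IsIBNAt Θ .second :=
  isIBNAt_of_freeModules (R := k) (fun X => trivialRep k PUnit (X →₀ k)) (fun _ => hΘ _)
    (fun _ => Equiv.refl _)
    (fun _ j => match j with
      | .first => PUnit.unit
      | .second => (0 : _ →₀ k))
    (fun _ j hj _ => match j, hj with
      | .first, _ => rfl
      | .second, hj => (hj rfl).elim)
    (fun _ _ l => ⟨trivialRepMap (MonoidHom.id _) l, fun _ => rfl⟩)

theorem isIBNAt_first {Θ : Set (Alg.{u} (repSig k))} {n : ℕ} [Nontrivial (ZMod n)]
    (hΘ : ∀ X : Type u, trivialRep k (Multiplicative (X →₀ ZMod n)) PUnit ∈ Θ) :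
    IsIBNAt Θ .first :=
  isIBNAt_of_freeModules (R := ZMod n)
    (fun X => trivialRep k (Multiplicative (X →₀ ZMod n)) PUnit) hΘ
    (fun _ => Multiplicative.toAdd)
    (fun X j => match j with
      | .first => (1 : Multiplicative (X →₀ ZMod n))
      | .second => PUnit.unit)
    (fun _ j hj _ => match j, hj with
      | .first, hj => (hj rfl).elim
      | .second, _ => rfl)
    (fun _ _ l => ⟨trivialRepMap (AddMonoidHom.toMultiplicative l.toAddMonoidHom) LinearMap.id, fun _ => rfl⟩)

/-- The restriction of a homomorphism to the first sort. -/
def Hom.firstPart {S₁ : Signature.{0, v} Unit} {S₂ : Signature.{0, w} Unit}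
    {A B : Alg.{u} (actionSig S₁ S₂)} (f : Hom A B) : Hom A.firstPart B.firstPart where
  toFun _ := f.toFun .first
  map_op ω a := f.map_op (Sum.inl ω) a

/-- The criterion applies directly to the group parts of the test algebras; free algebras of the two
varieties need not be compared. -/
theorem isIBN_firstVariety {Θ : Set (Alg.{u} (repSig k))} {n : ℕ} [Nontrivial (ZMod n)]
    (hΘ : ∀ X : Type u, trivialRep k (Multiplicative (X →₀ ZMod n)) PUnit ∈ Θ) :
    IsIBN (firstVariety Θ) := fun _ =>
  isIBNAt_of_freeModules (R := ZMod n)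
    (fun X => (trivialRep k (Multiplicative (X →₀ ZMod n)) PUnit).firstPart)
    (fun X => firstPart_mem_firstVariety (hΘ X))
    (fun _ => Multiplicative.toAdd)
    (fun X _ => (1 : Multiplicative (X →₀ ZMod n)))
    (fun _ _ hj _ => (hj rfl).elim)
    (fun _ _ l => ⟨(trivialRepMap (AddMonoidHom.toMultiplicative l.toAddMonoidHom) LinearMap.id).firstPart,
      fun _ => rfl⟩)

theorem secondVariety_subset_vectorSpaces {Θ : Set (Alg.{u} (repSig k))} (h : Θ ⊆ groupReps k) :
    secondVariety Θ ⊆ vectorSpaces k :=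
  var_subset_vectorSpaces fun e he A hA => (models_inSecond A e).2 (he _ (h hA).2.1)

theorem firstVariety_subset_groups {Θ : Set (Alg.{u} (repSig k))} (h : Θ ⊆ groupReps k) :
    firstVariety Θ ⊆ groups :=
  var_subset_groups fun e he A hA => (models_inFirst A e).2 (he _ (h hA).1)

/-- Every vector space is the second part of a member of `Θ`, so it satisfies all the defining
identities. -/
theorem vectorSpaces_subset_secondVariety {Θ : Set (Alg.{u} (repSig k))}
    (hΘ : ∀ (V : Type u) [AddCommGroup V] [Module k V], trivialRep k PUnit V ∈ Θ) :
    vectorSpaces k ⊆ secondVariety Θ := by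
  intro V hV e he
  let := addCommGroupOf hV
  let := moduleOf hV
  have := secondPart_mem_secondVariety (hΘ (V.carrier ())) e he
  -- The second part of the trivial representation is `V` itself, up to rewriting argument tuples.
  convert this
  obtain ⟨C, op⟩ := V
  refine congrArg (Alg.mk C) (funext fun ω => funext fun a => ?_)
  match ω with
  | .add => exact congrArg (op VectorOp.add) <| funext fun j => match j with
    | (0 : Fin 2) => rfl
    | (1 : Fin 2) => rfl
  | .neg => exact congrArg (op VectorOp.neg) <| funext fun j => match j with
    | (0 : Fin 1) => rfl
  | .zero => exact congrArg (op VectorOp.zero) <| funext fun j => Fin.elim0 j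
  | .smul c => exact congrArg (op (VectorOp.smul c)) <| funext fun j => match j with
    | (0 : Fin 1) => rfl

end ManySorted

/-- Let `Θ` be a nondegenerate variety of representations of groups over the field `k`, and let
`Δ` be its subvariety of representations with trivial action. Then `Θ` is an IBN-variety;
moreover `Θ⁽¹⁾` is a nondegenerate IBN-variety of groups, `Δ⁽²⁾` is the variety of all vector
spaces over `k`, and `Δ` is a `2`-nondegenerate `2`-IBN-variety. -/
theorem mainTheorem4 (k : Type u) [Field k] (Θ : Set (ManySorted.Alg.{u} (ManySorted.repSig k)))
    (hvar : ManySorted.IsVariety Θ) (hrep : Θ ⊆ ManySorted.groupReps k)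
    (hnd : ManySorted.Nondegenerate Θ) :
    ManySorted.IsIBN Θ ∧
    (ManySorted.firstVariety Θ ⊆ ManySorted.groups ∧
      ManySorted.Nondegenerate (ManySorted.firstVariety Θ) ∧
      ManySorted.IsIBN (ManySorted.firstVariety Θ)) ∧
    ManySorted.secondVariety (ManySorted.trivialActionSubvariety Θ) = ManySorted.vectorSpaces k ∧
    ManySorted.NondegenerateAt (ManySorted.trivialActionSubvariety Θ)
      ManySorted.TwoSorts.second ∧
    ManySorted.IsIBNAt (ManySorted.trivialActionSubvariety Θ)
      ManySorted.TwoSorts.second := by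
  open ManySorted in
  obtain ⟨A, hA, a, b, hab⟩ := (nondegenerateAt_iff fun _ _ => nonempty_carrier).1 (hnd .first)
  obtain ⟨B, hB, c, d, hcd⟩ := (nondegenerateAt_iff fun _ _ => nonempty_carrier).1 (hnd .second)
  obtain ⟨n, hn, hfirst⟩ := exists_trivialRep_punit_right_mem hvar hrep hA hab
  have hsecond : ∀ (V : Type u) [AddCommGroup V] [Module k V], trivialRep k PUnit V ∈ Θ :=
    fun V _ _ => trivialRep_punit_left_mem hvar hrep hB hcd V
  have hsecond' : ∀ (V : Type u) [AddCommGroup V] [Module k V],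
      trivialRep k PUnit V ∈ trivialActionSubvariety Θ := by
    rintro V _ _
    refine ⟨hsecond V, ?_⟩
    rintro _ rfl
    exact (models_trivialAction _).2 fun _ _ => rfl
  refine ⟨?_, ⟨firstVariety_subset_groups hrep, ?_, isIBN_firstVariety hfirst⟩,
    Set.Subset.antisymm (secondVariety_subset_vectorSpaces fun _ h => hrep h.1)
      (vectorSpaces_subset_secondVariety hsecond'), ?_, isIBNAt_second hsecond'⟩
  · rintro (_ | _)
    · exact isIBNAt_first hfirst
    · exact isIBNAt_second hsecond
  · intro i
    exact (nondegenerateAt_iff fun G _ _ => ⟨gone G⟩).2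
      ⟨A.firstPart, firstPart_mem_firstVariety hA, a, b, hab⟩
  · exact (nondegenerateAt_iff fun _ _ => nonempty_carrier).2
      -- The witness is the line `k` with the trivial group acting.
      ⟨_, hsecond' k, (0 : k), (1 : k), zero_ne_one (α := k)⟩
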